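/- **Setting.** Let $\mathbb P\subset\mathbb R^{n_p}$ be nonempty, compact and convex, and consider the LPV system $x_{k+1}=A(p_k)x_k+B(p_k)u_k$ with $A(p)=A_0+\sum_{i=1}^{n_p}p_iA_i\in\mathbb R^{n_x\times n_x}$, $B(p)=B_0+\sum_{i=1}^{n_p}p_iB_i\in\mathbb R^{n_x\times n_u}$. Let $(u_k,p_k,x_k)_{k=1}^{N_d}$, with $N_d\ge 1$, be samples of a trajectory of it with $p_k\in\mathbb P$, and let $z_k=x_k+\varepsilon_k$ be noisy state measurements. Put $T=N_d-1$, $$U=[u_1\cdots u_T],\quad U^{\mathsf p}=[p_1\otimes u_1\cdots p_T\otimes u_T],\quad Z=[z_1\cdots z_T],\quad Z^{\mathsf p}=[p_1\otimes z_1\cdots p_T\otimes z_T],\quad Z_+=[z_2\cdots z_{N_d}],$$ and define $E,E^{\mathsf p},E_+$ from $\varepsilon_k$ as $Z,Z^{\mathsf p},Z_+$ are defined from $z_k$. Let $\mathcal G=\begin{bmatrix}Z^\top&(Z^{\mathsf p})^\top&U^\top&(U^{\mathsf p})^\top\end{bmatrix}^\top$. Assume 1. $\mathcal G$ and $Z_+$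 have full row rank; 2. for some $\epsilon>0$, $R_-R_-^\top\preccurlyeq\epsilon Z_+Z_+^\top$, where $R_-=[A_0\ A_1\cdots A_{n_p}]\begin{bmatrix}E\\E^{\mathsf p}\end{bmatrix}-E_+$. For $F_Q\in\mathbb R^{T(1+n_p)\times n_x(1+n_p)}$ let $$F(p)=\begin{bmatrix}I_T\\p\otimes I_T\end{bmatrix}^\top F_Q\begin{bmatrix}I_{n_x}\\p\otimes I_{n_x}\end{bmatrix},$$ and let $\mathcal F\in\mathbb R^{T\times n_x(1+n_p+n_p^2)}$ be such that $F(p)=\mathcal F\begin{bmatrix}I_{n_x}\\p\otimes I_{n_x}\\p\otimes p\otimes I_{n_x}\end{bmatrix}$ for all $p\in\mathbb P$. For $\alpha>0$, a symmetric $P\in\mathbb R^{n_x\times n_x}$, $Y_0\in\mathbb R^{n_u\times n_x}$ and $\bar Y\in\mathbb R^{n_u\times n_xn_p}$ consider $$\begin{bmatrix}P&0&0\\0&I_{n_p}\otimes P&0\\Y_0&\bar Y&0\\0&I_{n_p}\otimes Y_0&I_{n_p}\otimes\bar Y\end{bmatrix}=\mathcal G\,\mathcal F,\tag{1}$$ $$\begin{bmatrix}P-\alpha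 Z_+Z_+^\top&Z_+F(p)\\(Z_+F(p))^\top&P\end{bmatrix}\succ0,\qquad\begin{bmatrix}I_T&F(p)\\F(p)^\top&P\end{bmatrix}\succ0\qquad\text{for all }p\in\mathbb P.\tag{2}$$ Let $\mathcal Z_+=\mathrm{blkdiag}(Z_+,I_{n_p}\otimes Z_+)$ and $$\Delta(p)=\mathrm{blkdiag}\big(\mathrm{diag}(p)\otimes I_{n_x},\ \mathrm{diag}(p)\otimes I_{n_x},\ \mathrm{diag}(p)\otimes I_T,\ \mathrm{diag}(p)\otimes I_{n_x}\big),$$ $$W=\mathrm{blkdiag}\left(\begin{bmatrix}\mathrm{blkdiag}(P-\alpha Z_+Z_+^\top,0_{n_xn_p})&\mathcal Z_+F_Q\\(\mathcal Z_+F_Q)^\top&\mathrm{blkdiag}(P,0_{n_xn_p})\end{bmatrix},\ \begin{bmatrix}\mathrm{blkdiag}(I_T,0_{Tn_p})&F_Q\\F_Q^\top&\mathrm{blkdiag}(P,0_{n_xn_p})\end{bmatrix}\right),$$ $L_{11}=0$, and let $L_{12},L_{21},L_{22}$ be block diagonal with four diagonal blocks $1_{n_p}\otimes I_n$, $\begin{bmatrix}0_{n\times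 nn_p}\\I_{nn_p}\end{bmatrix}$, $\begin{bmatrix}I_n\\0_{nn_p\times n}\end{bmatrix}$ respectively, where $n=n_x,n_x,T,n_x$ in this order and $1_{n_p}$ is the all-ones vector. For a symmetric matrix $\Xi$ of size $2n_p(3n_x+N_d-1)$ consider $$\begin{bmatrix}L_{11}&L_{12}\\I&0\\L_{21}&L_{22}\end{bmatrix}^\top\begin{bmatrix}\Xi&0\\0&-W\end{bmatrix}\begin{bmatrix}L_{11}&L_{12}\\I&0\\L_{21}&L_{22}\end{bmatrix}\prec0,\qquad\begin{bmatrix}I\\\Delta(p)\end{bmatrix}^\top\Xi\begin{bmatrix}I\\\Delta(p)\end{bmatrix}\succeq0\quad\text{for all }p\in\mathbb P.\tag{3}$$ **Claim.** For all $\alpha>0$, symmetric $P$, and $F_Q,\mathcal F,Y_0,\bar Y$ as above, (1) and (2) hold if and only if $P\succ0$, (1) holds, and there is a symmetric $\Xi$ satisfying (3). In particular, there exist $\alpha>0$, a symmetric $P$ and $F_Q,\mathcal F,Y_0,\bar Y$ satisfying (1) and (2) if and only if there exist $\alpha>0$, $P\succ0$, $F_Q,\mathcal F,Y_0,\bar Y$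 and a symmetric $\Xi$ satisfying (1) and (3). -/

import Mathlib

open Matrix
open scoped Kronecker

noncomputable section

namespace LPV

/-- The Kronecker product `p ⊗ M` of a column vector `p` and a matrix `M`. -/
def kronVec {ι m n : Type*} (p : ι → ℝ) (M : Matrix m n ℝ) : Matrix (ι × m) n ℝ :=
  Matrix.of fun i j => p i.1 * M i.2 j

/-- `blkdiag(A, B, C, D)`. -/
def blkdiag4 {m₁ m₂ m₃ m₄ n₁ n₂ n₃ n₄ : Type*}
    (A : Matrix m₁ n₁ ℝ) (B : Matrix m₂ n₂ ℝ) (C : Matrix m₃ n₃ ℝ) (D : Matrix m₄ n₄ ℝ) :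
    Matrix ((m₁ ⊕ m₂) ⊕ (m₃ ⊕ m₄)) ((n₁ ⊕ n₂) ⊕ (n₃ ⊕ n₄)) ℝ :=
  fromBlocks (fromBlocks A 0 0 B) 0 0 (fromBlocks C 0 0 D)

/-- The coefficients of a discrete-time LPV state-space system with affine scheduling dependence,
`A(p) = A₀ + ∑ pᵢ Aᵢ` and `B(p) = B₀ + ∑ pᵢ Bᵢ`. -/
structure System (nx nu np : ℕ) where
  A₀ : Matrix (Fin nx) (Fin nx) ℝ
  A : Fin np → Matrix (Fin nx) (Fin nx) ℝ
  B₀ : Matrix (Fin nx) (Fin nu) ℝ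
  B : Fin np → Matrix (Fin nx) (Fin nu) ℝ

namespace System

variable {nx nu np : ℕ} (S : System nx nu np)

/-- `A(p)` -/
def Aof (p : Fin np → ℝ) : Matrix (Fin nx) (Fin nx) ℝ := S.A₀ + ∑ i, p i • S.A i

/-- `B(p)` -/
def Bof (p : Fin np → ℝ) : Matrix (Fin nx) (Fin nu) ℝ := S.B₀ + ∑ i, p i • S.B i

/-- `𝒜 = [A₀ A₁ ⋯ A_np]` -/
def calA : Matrix (Fin nx) (Fin nx ⊕ Fin np × Fin nx) ℝ :=
  fromCols S.A₀ (Matrix.of fun a ib => S.A ib.1 a ib.2)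

end System

/-- Input, scheduling, state and measurement-noise samples at the times `1, …, N_d`, where
`N_d = T + 1` (time `k` is stored at index `k - 1`). Only `u`, `p` and `z = x + e` are measured. -/
structure Experiment (nx nu np T : ℕ) where
  u : Fin (T + 1) → Fin nu → ℝ
  p : Fin (T + 1) → Fin np → ℝ
  x : Fin (T + 1) → Fin nx → ℝ
  e : Fin (T + 1) → Fin nx → ℝ

namespace Experiment

variable {nx nu np T : ℕ} (D : Experiment nx nu np T)

/-- The samples form a trajectory of the system, with scheduling values in `ℙ`. -/
def IsTrajectoryOf (S : System nx nu np) (ℙ : Set (Fin np → ℝ)) : Prop :=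
  (∀ k, D.p k ∈ ℙ) ∧
    ∀ k : Fin T, D.x k.succ =
      S.Aof (D.p k.castSucc) *ᵥ D.x k.castSucc + S.Bof (D.p k.castSucc) *ᵥ D.u k.castSucc

/-- The noisy state measurements `z = x + e`. -/
def z (k : Fin (T + 1)) : Fin nx → ℝ := D.x k + D.e k

/-- `U = [u₁ ⋯ u_{N_d - 1}]` -/
def U : Matrix (Fin nu) (Fin T) ℝ := Matrix.of fun a k => D.u k.castSucc a

/-- `Uᵖ = [p₁ ⊗ u₁ ⋯ p_{N_d - 1} ⊗ u_{N_d - 1}]` -/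
def Up : Matrix (Fin np × Fin nu) (Fin T) ℝ :=
  Matrix.of fun ia k => D.p k.castSucc ia.1 * D.u k.castSucc ia.2

/-- `Z = [z₁ ⋯ z_{N_d - 1}]` -/
def Z : Matrix (Fin nx) (Fin T) ℝ := Matrix.of fun a k => D.z k.castSucc a

/-- `Zᵖ = [p₁ ⊗ z₁ ⋯ p_{N_d - 1} ⊗ z_{N_d - 1}]` -/
def Zp : Matrix (Fin np × Fin nx) (Fin T) ℝ :=
  Matrix.of fun ia k => D.p k.castSucc ia.1 * D.z k.castSucc ia.2

/-- `Z₊ = [z₂ ⋯ z_{N_d}]` -/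
def Zplus : Matrix (Fin nx) (Fin T) ℝ := Matrix.of fun a k => D.z k.succ a

/-- `E = [e₁ ⋯ e_{N_d - 1}]` -/
def E : Matrix (Fin nx) (Fin T) ℝ := Matrix.of fun a k => D.e k.castSucc a

/-- `Eᵖ = [p₁ ⊗ e₁ ⋯ p_{N_d - 1} ⊗ e_{N_d - 1}]` -/
def Ep : Matrix (Fin np × Fin nx) (Fin T) ℝ :=
  Matrix.of fun ia k => D.p k.castSucc ia.1 * D.e k.castSucc ia.2

/-- `E₊ = [e₂ ⋯ e_{N_d}]` -/
def Eplus : Matrix (Fin nx) (Fin T) ℝ := Matrix.of fun a k => D.e k.succ a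

/-- The stacked noisy data matrix `[Z; Zᵖ; U; Uᵖ]`. -/
def G : Matrix (Fin nx ⊕ (Fin np × Fin nx) ⊕ Fin nu ⊕ (Fin np × Fin nu)) (Fin T) ℝ :=
  fromRows D.Z (fromRows D.Zp (fromRows D.U D.Up))

/-- Persistency of excitation: `[Z; Zᵖ; U; Uᵖ]` and `Z₊` have full row rank. -/
def PersistentlyExciting : Prop :=
  D.G.rank = (1 + np) * (nx + nu) ∧ D.Zplus.rank = nx

/-- `R₋ = 𝒜 [E; Eᵖ] - E₊` -/
def Rminus (S : System nx nu np) : Matrix (Fin nx) (Fin T) ℝ :=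
  S.calA * fromRows D.E D.Ep - D.Eplus

/-- The signal-to-noise condition `R₋ R₋ᵀ ≼ ε Z₊ Z₊ᵀ`. -/
def NoiseBound (S : System nx nu np) (ε : ℝ) : Prop :=
  (ε • (D.Zplus * D.Zplusᵀ) - D.Rminus S * (D.Rminus S)ᵀ).PosSemidef

end Experiment

/-- `[I; p ⊗ I]` -/
def lift₁ {np : ℕ} (n : ℕ) (p : Fin np → ℝ) :
    Matrix (Fin n ⊕ Fin np × Fin n) (Fin n) ℝ :=
  fromRows 1 (kronVec p 1)

/-- `[I; p ⊗ I; p ⊗ p ⊗ I]` -/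
def lift₂ {np : ℕ} (n : ℕ) (p : Fin np → ℝ) :
    Matrix (Fin n ⊕ (Fin np × Fin n) ⊕ (Fin np × Fin np × Fin n)) (Fin n) ℝ :=
  fromRows 1 (fromRows (kronVec p 1) (kronVec p (kronVec p 1)))

section Conditions

variable {nx nu np T : ℕ}

/-- `F(p) = [I; p ⊗ I]ᵀ F_Q [I; p ⊗ I]` -/
def Fof (FQ : Matrix (Fin T ⊕ Fin np × Fin T) (Fin nx ⊕ Fin np × Fin nx) ℝ)
    (p : Fin np → ℝ) : Matrix (Fin T) (Fin nx) ℝ :=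
  (lift₁ T p)ᵀ * FQ * lift₁ nx p

/-- `ℱ` and `F_Q` define the same matrix function `F` on the scheduling set:
`F(p) = ℱ [I; p ⊗ I; p ⊗ p ⊗ I] = [I; p ⊗ I]ᵀ F_Q [I; p ⊗ I]`. -/
def SameF (ℙ : Set (Fin np → ℝ))
    (calF : Matrix (Fin T) (Fin nx ⊕ (Fin np × Fin nx) ⊕ (Fin np × Fin np × Fin nx)) ℝ)
    (FQ : Matrix (Fin T ⊕ Fin np × Fin T) (Fin nx ⊕ Fin np × Fin nx) ℝ) : Prop :=
  ∀ p ∈ ℙ, calF * lift₂ nx p = Fof FQ p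

/-- The coupling equality
`[P 0 0; 0 I⊗P 0; Y₀ Ȳ 0; 0 I⊗Y₀ I⊗Ȳ] = [Z; Zᵖ; U; Uᵖ] ℱ`. -/
def Coupling (D : Experiment nx nu np T) (P : Matrix (Fin nx) (Fin nx) ℝ)
    (Y₀ : Matrix (Fin nu) (Fin nx) ℝ) (Ybar : Matrix (Fin nu) (Fin np × Fin nx) ℝ)
    (calF : Matrix (Fin T) (Fin nx ⊕ (Fin np × Fin nx) ⊕ (Fin np × Fin np × Fin nx)) ℝ) :
    Prop :=
  fromRows (fromCols P (fromCols 0 0))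
    (fromRows (fromCols 0 (fromCols ((1 : Matrix (Fin np) (Fin np) ℝ) ⊗ₖ P) 0))
      (fromRows (fromCols Y₀ (fromCols Ybar 0))
        (fromCols 0 (fromCols ((1 : Matrix (Fin np) (Fin np) ℝ) ⊗ₖ Y₀)
          ((1 : Matrix (Fin np) (Fin np) ℝ) ⊗ₖ Ybar))))) = D.G * calF

/-- The two `p`-dependent matrix inequalities
`[P - α Z₊ Z₊ᵀ, Z₊ F(p); (Z₊ F(p))ᵀ, P] ≻ 0` and `[I, F(p); F(p)ᵀ, P] ≻ 0`. -/
def SynthesisIneq (D : Experiment nx nu np T) (α : ℝ) (P : Matrix (Fin nx) (Fin nx) ℝ)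
    (FQ : Matrix (Fin T ⊕ Fin np × Fin T) (Fin nx ⊕ Fin np × Fin nx) ℝ)
    (p : Fin np → ℝ) : Prop :=
  (fromBlocks (P - α • (D.Zplus * D.Zplusᵀ)) (D.Zplus * Fof FQ p)
      (D.Zplus * Fof FQ p)ᵀ P).PosDef ∧
    (fromBlocks 1 (Fof FQ p) (Fof FQ p)ᵀ P).PosDef

/-- `[L₁₁ L₁₂; I 0; L₂₁ L₂₂]` -/
def outerL {δ ω κ : Type*} [DecidableEq δ] (L₁₁ : Matrix δ δ ℝ) (L₁₂ : Matrix δ κ ℝ)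
    (L₂₁ : Matrix ω δ ℝ) (L₂₂ : Matrix ω κ ℝ) : Matrix ((δ ⊕ δ) ⊕ ω) (δ ⊕ κ) ℝ :=
  fromRows (fromRows (fromCols L₁₁ L₁₂) (fromCols 1 0)) (fromCols L₂₁ L₂₂)

/-- `[I; M]` -/
def graphMat {δ : Type*} [DecidableEq δ] (M : Matrix δ δ ℝ) : Matrix (δ ⊕ δ) δ ℝ :=
  fromRows 1 M

/-- The multiplier conditions of the full-block S-procedure:
`[L₁₁ L₁₂; I 0; L₂₁ L₂₂]ᵀ blkdiag(Ξ, -W) [L₁₁ L₁₂; I 0; L₂₁ L₂₂] ≺ 0` and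
`[I; Δ(p)]ᵀ Ξ [I; Δ(p)] ≽ 0` for all `p ∈ ℙ`. -/
def MultiplierLMI {δ ω κ : Type*} [Fintype δ] [DecidableEq δ] [Fintype ω] [Fintype κ]
    (ℙ : Set (Fin np → ℝ)) (Δ : (Fin np → ℝ) → Matrix δ δ ℝ) (W : Matrix ω ω ℝ)
    (L₁₁ : Matrix δ δ ℝ) (L₁₂ : Matrix δ κ ℝ) (L₂₁ : Matrix ω δ ℝ) (L₂₂ : Matrix ω κ ℝ)
    (Ξ : Matrix (δ ⊕ δ) (δ ⊕ δ) ℝ) : Prop :=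
  (-((outerL L₁₁ L₁₂ L₂₁ L₂₂)ᵀ * fromBlocks Ξ 0 0 (-W) * outerL L₁₁ L₁₂ L₂₁ L₂₂)).PosDef ∧
    ∀ p ∈ ℙ, ((graphMat (Δ p))ᵀ * Ξ * graphMat (Δ p)).PosSemidef

/-- Index type of `Δ(p)`; it has `n_p (3 n_x + N_d - 1)` elements, with `T = N_d - 1`. -/
abbrev DeltaIdx (nx np T : ℕ) : Type :=
  (Fin np × Fin nx ⊕ Fin np × Fin nx) ⊕ (Fin np × Fin T ⊕ Fin np × Fin nx)

/-- Index type of `W`. -/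
abbrev WIdx (nx np T : ℕ) : Type :=
  ((Fin nx ⊕ Fin np × Fin nx) ⊕ (Fin nx ⊕ Fin np × Fin nx)) ⊕
    ((Fin T ⊕ Fin np × Fin T) ⊕ (Fin nx ⊕ Fin np × Fin nx))

/-- Index type of the columns of `L₁₂` and `L₂₂`. -/
abbrev LIdx (nx T : ℕ) : Type := (Fin nx ⊕ Fin nx) ⊕ (Fin T ⊕ Fin nx)

/-- `Δ(p) = blkdiag(diag(p) ⊗ I_nx, diag(p) ⊗ I_nx, diag(p) ⊗ I_{N_d - 1}, diag(p) ⊗ I_nx)` -/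
def Delta (nx T : ℕ) (p : Fin np → ℝ) : Matrix (DeltaIdx nx np T) (DeltaIdx nx np T) ℝ :=
  blkdiag4 (diagonal p ⊗ₖ 1) (diagonal p ⊗ₖ 1) (diagonal p ⊗ₖ 1) (diagonal p ⊗ₖ 1)

/-- `𝒵₊ = blkdiag(Z₊, I_np ⊗ Z₊)` -/
def calZplus (D : Experiment nx nu np T) :
    Matrix (Fin nx ⊕ Fin np × Fin nx) (Fin T ⊕ Fin np × Fin T) ℝ :=
  fromBlocks D.Zplus 0 0 ((1 : Matrix (Fin np) (Fin np) ℝ) ⊗ₖ D.Zplus)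

/-- `blkdiag(M, 0)`, padded by `n_p n` zero rows and columns. -/
def pad (np : ℕ) {n : ℕ} (M : Matrix (Fin n) (Fin n) ℝ) :
    Matrix (Fin n ⊕ Fin np × Fin n) (Fin n ⊕ Fin np × Fin n) ℝ :=
  fromBlocks M 0 0 0

/-- The block-diagonal matrix `W` with the diagonal blocks
`[blkdiag(P - α Z₊ Z₊ᵀ, 0), 𝒵₊ F_Q; (𝒵₊ F_Q)ᵀ, blkdiag(P, 0)]` and
`[blkdiag(I, 0), F_Q; F_Qᵀ, blkdiag(P, 0)]`. -/
def Wmat (D : Experiment nx nu np T) (α : ℝ) (P : Matrix (Fin nx) (Fin nx) ℝ)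
    (FQ : Matrix (Fin T ⊕ Fin np × Fin T) (Fin nx ⊕ Fin np × Fin nx) ℝ) :
    Matrix (WIdx nx np T) (WIdx nx np T) ℝ :=
  fromBlocks
    (fromBlocks (pad np (P - α • (D.Zplus * D.Zplusᵀ))) (calZplus D * FQ)
      (calZplus D * FQ)ᵀ (pad np P))
    0 0
    (fromBlocks (pad np 1) FQ FQᵀ (pad np P))

/-- `L₁₁ = 0` -/
def L11 (nx np T : ℕ) : Matrix (DeltaIdx nx np T) (DeltaIdx nx np T) ℝ := 0

/-- `L₁₂ = blkdiag(1_np ⊗ I_nx, 1_np ⊗ I_nx, 1_np ⊗ I_{N_d - 1}, 1_np ⊗ I_nx)` -/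
def L12 (nx np T : ℕ) : Matrix (DeltaIdx nx np T) (LIdx nx T) ℝ :=
  blkdiag4 (kronVec (fun _ => 1) 1) (kronVec (fun _ => 1) 1) (kronVec (fun _ => 1) 1)
    (kronVec (fun _ => 1) 1)

/-- `L₂₁ = blkdiag([0; I], [0; I], [0; I], [0; I])` -/
def L21 (nx np T : ℕ) : Matrix (WIdx nx np T) (DeltaIdx nx np T) ℝ :=
  blkdiag4 (fromRows 0 1) (fromRows 0 1) (fromRows 0 1) (fromRows 0 1)

/-- `L₂₂ = blkdiag([I; 0], [I; 0], [I; 0], [I; 0])` -/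
def L22 (nx np T : ℕ) : Matrix (WIdx nx np T) (LIdx nx T) ℝ :=
  blkdiag4 (fromRows 1 0) (fromRows 1 0) (fromRows 1 0) (fromRows 1 0)

/-- The full-block S-procedure LMIs for the data `D`, the scheduling set `ℙ`, the decision
variables `α`, `P`, `F_Q` and the multiplier `Ξ`. -/
def NoisyLMI (D : Experiment nx nu np T) (ℙ : Set (Fin np → ℝ)) (α : ℝ)
    (P : Matrix (Fin nx) (Fin nx) ℝ)
    (FQ : Matrix (Fin T ⊕ Fin np × Fin T) (Fin nx ⊕ Fin np × Fin nx) ℝ)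
    (Ξ : Matrix (DeltaIdx nx np T ⊕ DeltaIdx nx np T)
      (DeltaIdx nx np T ⊕ DeltaIdx nx np T) ℝ) : Prop :=
  MultiplierLMI ℙ (Delta nx T) (Wmat D α P FQ)
    (L11 nx np T) (L12 nx np T) (L21 nx np T) (L22 nx np T) Ξ

end Conditions

end LPV

end

/-! The statement is a lossless full-block S-procedure. Closing the loop `w = Δ(p) L₁₂ v` turns
`[L₂₁ L₂₂]` into `L₂₁ Δ(p) L₁₂ + L₂₂`, and here this is the block diagonal of the lifts `[I; p ⊗
I]`. Congruence of `W` with it yields exactly the two synthesis inequalities, side by side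
(`congruence_Wmat`). The coupling equality is only carried along.

From a multiplier to the inequalities: restrict the strict LMI to the graph `w = Δ(p) L₁₂ v` and add
the multiplier condition; `Ξ` cancels (`MultiplierLMI.posDef`).

Conversely, `Ξ` is written down explicitly. Let `N = [L₂₁ L₂₂]ᵀ W [L₂₁ L₂₂]`, and let `K` be a left
inverse of `L₁₂`. The pulled-back form `[Δ(p); K]ᵀ N [Δ(p); K]` is positive on the range of `L₁₂`.
Finsler's lemma, uniform over the compact scheduling set, makes it positive everywhere after adding
a penalty `M • CᵀC` that vanishes on that range. A small `η` is then spent on strictness of the LMI.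
-/

namespace LPV

/-! ### Uniform Finsler lemma over a compact parameter set. -/

section Compactness

open Set

variable {X δ : Type*} [TopologicalSpace X]

/-- Since `g ≥ 0` on `K`, the open sets where `f + (n + 1) g > 0` grow with `n` on `K`, and they
cover it; a finite subcover bounds the required `n`. -/
lemma exists_pos_forall_add_mul_pos {K : Set X} (hK : IsCompact K) {f g : X → ℝ}
    (hf : Continuous f) (hg : Continuous g) (hg0 : ∀ x ∈ K, 0 ≤ g x)
    (h : ∀ x ∈ K, g x = 0 → 0 < f x) : ∃ M : ℝ, 0 < M ∧ ∀ x ∈ K, 0 < f x + M * g x := by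
  obtain ⟨t, ht⟩ := hK.elim_finite_subcover
    (fun n : ℕ => {x | 0 < f x + (n + 1 : ℝ) * g x})
    (fun n => isOpen_lt continuous_const (hf.add (continuous_const.mul hg))) (fun x hx => by
      rw [mem_iUnion]
      rcases (hg0 x hx).eq_or_lt with h0 | h0
      · exact ⟨0, by simpa [← h0] using h x hx h0.symm⟩
      · obtain ⟨n, hn⟩ := exists_nat_gt (-f x / g x)
        refine ⟨n, ?_⟩
        rw [div_lt_iff₀ h0] at hn
        simp only [mem_ofPred_eq]
        linarith)
  -- The largest index in the subcover; the `+ 1` keeps `M` positive even for an empty subcover.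
  refine ⟨t.sup id + 1, by positivity, fun x hx => ?_⟩
  obtain ⟨n, hn, hx'⟩ := mem_iUnion₂.1 (ht hx)
  have hle : (n : ℝ) ≤ t.sup id := by exact_mod_cast Finset.le_sup (f := id) hn
  simp only [mem_ofPred_eq] at hx'
  nlinarith [mul_le_mul_of_nonneg_right hle (hg0 x hx)]

variable [Fintype δ]

/-- Finsler's lemma with one constant for all parameters: by homogeneity it suffices to test unit
vectors, and `K` times the unit sphere is compact. -/
lemma exists_pos_forall_posDef_add_smul {K : Set X} (hK : IsCompact K) {A B : X → Matrix δ δ ℝ}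
    (hA : Continuous A) (hB : Continuous B) (hAs : ∀ x ∈ K, (A x).IsHermitian)
    (hBs : ∀ x ∈ K, (B x).PosSemidef)
    (h : ∀ x ∈ K, ∀ q : δ → ℝ, q ≠ 0 → q ⬝ᵥ (B x *ᵥ q) = 0 → 0 < q ⬝ᵥ (A x *ᵥ q)) :
    ∃ M : ℝ, 0 < M ∧ ∀ x ∈ K, (A x + M • B x).PosDef := by
  have hcont {C : X → Matrix δ δ ℝ} (hC : Continuous C) :
      Continuous fun y : X × (δ → ℝ) => y.2 ⬝ᵥ (C y.1 *ᵥ y.2) :=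
    continuous_snd.dotProduct ((hC.comp continuous_fst).matrix_mulVec continuous_snd)
  obtain ⟨M, hM, hpos⟩ := exists_pos_forall_add_mul_pos
    (hK.prod (isCompact_sphere (0 : δ → ℝ) 1)) (hcont hA) (hcont hB)
    (fun y hy => by simpa using (hBs y.1 hy.1).dotProduct_mulVec_nonneg y.2)
    (fun y hy => h y.1 hy.1 y.2 (ne_zero_of_mem_sphere one_ne_zero ⟨y.2, hy.2⟩))
  refine ⟨M, hM, fun x hx => .of_dotProduct_mulVec_pos
    ((hAs x hx).add (((hBs x hx).smul hM.le).isHermitian)) fun q hq => ?_⟩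
  have hq' : 0 < ‖q‖ := norm_pos_iff.2 hq
  have := hpos (x, ‖q‖⁻¹ • q) ⟨hx, by simp [norm_smul, hq'.ne']⟩
  simp only [mulVec_smul, smul_dotProduct, dotProduct_smul, smul_eq_mul] at this
  have h2 : 0 < ‖q‖⁻¹ * ‖q‖⁻¹ * (q ⬝ᵥ (A x *ᵥ q) + M * (q ⬝ᵥ (B x *ᵥ q))) := by linarith
  have := (mul_pos_iff_of_pos_left (by positivity)).1 h2
  simpa [add_mulVec, smul_mulVec, dotProduct_add] using this

lemma exists_pos_forall_posDef_sub_smul {K : Set X} (hK : IsCompact K) {A B : X → Matrix δ δ ℝ}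
    (hA : Continuous A) (hB : Continuous B) (hAp : ∀ x ∈ K, (A x).PosDef)
    (hBs : ∀ x ∈ K, (B x).IsHermitian) :
    ∃ η : ℝ, 0 < η ∧ ∀ x ∈ K, (A x - η • B x).PosDef := by
  -- Finsler for `-B` penalised by `A`: the kernel condition is vacuous because `A` is definite.
  -- Dividing by `M` gives `η = M⁻¹`.
  obtain ⟨M, hM, h⟩ := exists_pos_forall_posDef_add_smul hK hB.neg hA (fun x hx => (hBs x hx).neg)
    (fun x hx => (hAp x hx).posSemidef) (fun x hx q hq h0 =>
      absurd h0 (by simpa using ((hAp x hx).dotProduct_mulVec_pos hq).ne'))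
  refine ⟨M⁻¹, inv_pos.2 hM, fun x hx => ?_⟩
  have := (h x hx).smul (inv_pos.2 hM)
  rwa [smul_add, smul_smul, inv_mul_cancel₀ hM.ne', one_smul, Pi.neg_apply, smul_neg,
    neg_add_eq_sub] at this

end Compactness

/-! ### The full-block S-procedure with `L₁₁ = 0`. -/

section SProcedure

variable {np : ℕ} {δ ω κ : Type*} [Fintype δ] [DecidableEq δ] [Fintype ω] [Fintype κ]
  {ℙ : Set (Fin np → ℝ)} {Δ : (Fin np → ℝ) → Matrix δ δ ℝ} {W : Matrix ω ω ℝ}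
  {L₁₂ : Matrix δ κ ℝ} {L₂₁ : Matrix ω δ ℝ} {L₂₂ : Matrix ω κ ℝ}

omit [Fintype ω] in
lemma outerL_mul_graph (M : Matrix δ δ ℝ) (L₁₂ : Matrix δ κ ℝ) (L₂₁ : Matrix ω δ ℝ)
    (L₂₂ : Matrix ω κ ℝ) [DecidableEq κ] :
    outerL 0 L₁₂ L₂₁ L₂₂ * fromRows (M * L₁₂) (1 : Matrix κ κ ℝ) =
      fromRows (graphMat M * L₁₂) (L₂₁ * M * L₁₂ + L₂₂) := by
  rw [outerL, graphMat, fromRows_mul, fromRows_mul, fromRows_mul]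
  simp only [fromCols_mul_fromRows, Matrix.mul_assoc, Matrix.zero_mul, Matrix.one_mul,
    Matrix.mul_one, add_zero, zero_add]

lemma fromRows_congruence {m₁ m₂ n : Type*} [Fintype m₁] [Fintype m₂]
    (A : Matrix m₁ n ℝ) (B : Matrix m₂ n ℝ) (M : Matrix m₁ m₁ ℝ) (N : Matrix m₂ m₂ ℝ) :
    (fromRows A B)ᵀ * fromBlocks M 0 0 N * fromRows A B = Aᵀ * M * A + Bᵀ * N * B := by
  rw [Matrix.mul_assoc, fromBlocks_mul_fromRows, transpose_fromRows, fromCols_mul_fromRows]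
  simp [Matrix.mul_assoc]

lemma isSymm_transpose_mul_mul {m n : Type*} [Fintype m] {A : Matrix m m ℝ} (hA : A.IsSymm)
    (B : Matrix m n ℝ) : (Bᵀ * A * B).IsSymm := by
  simp [IsSymm, Matrix.transpose_mul, hA.eq, Matrix.mul_assoc]

lemma dotProduct_congruence_mulVec {m n : Type*} [Fintype m] [Fintype n] (A : Matrix m m ℝ)
    (B : Matrix m n ℝ) (y : n → ℝ) :
    y ⬝ᵥ ((Bᵀ * A * B) *ᵥ y) = (B *ᵥ y) ⬝ᵥ (A *ᵥ (B *ᵥ y)) := by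
  rw [← mulVec_mulVec, ← mulVec_mulVec, dotProduct_mulVec, vecMul_transpose]

lemma MultiplierLMI.posDef {Ξ : Matrix (δ ⊕ δ) (δ ⊕ δ) ℝ}
    (h : MultiplierLMI ℙ Δ W 0 L₁₂ L₂₁ L₂₂ Ξ) {p : Fin np → ℝ} (hp : p ∈ ℙ) :
    ((L₂₁ * Δ p * L₁₂ + L₂₂)ᵀ * W * (L₂₁ * Δ p * L₁₂ + L₂₂)).PosDef := by
  classical
  -- The identity block makes `[Δ(p) L₁₂; I]` injective, so definiteness survives the congruence.
  have h1 := h.1.conjTranspose_mul_mul_same (B := fromRows (Δ p * L₁₂) (1 : Matrix κ κ ℝ))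
    (fun v w hvw => by
      simp only [fromRows_mulVec, one_mulVec] at hvw
      exact (Sum.elim_eq_iff.1 hvw).2)
  have h2 := (h.2 p hp).conjTranspose_mul_mul_same L₁₂
  rw [conjTranspose_eq_transpose_of_trivial] at h1 h2
  have h3 := h1.add_posSemidef h2
  convert h3 using 1
  rw [Matrix.mul_neg, Matrix.neg_mul, ← Matrix.mul_assoc, ← Matrix.mul_assoc,
    ← Matrix.transpose_mul, Matrix.mul_assoc _ (outerL _ _ _ _), outerL_mul_graph,
    fromRows_congruence]
  simp [Matrix.mul_assoc, Matrix.transpose_mul]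

lemma exists_multiplierLMI_of_leftInverse [DecidableEq κ] (hℙ : IsCompact ℙ) (hΔ : Continuous Δ)
    (hW : W.IsSymm) {K : Matrix κ δ ℝ} (hK : K * L₁₂ = 1)
    (h : ∀ p ∈ ℙ, ((L₂₁ * Δ p * L₁₂ + L₂₂)ᵀ * W * (L₂₁ * Δ p * L₁₂ + L₂₂)).PosDef) :
    ∃ Ξ : Matrix (δ ⊕ δ) (δ ⊕ δ) ℝ, Ξ.IsSymm ∧ MultiplierLMI ℙ Δ W 0 L₁₂ L₂₁ L₂₂ Ξ := by
  set N : Matrix (δ ⊕ κ) (δ ⊕ κ) ℝ := (fromCols L₂₁ L₂₂)ᵀ * W * fromCols L₂₁ L₂₂ with hN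
  have hNs : N.IsSymm := by
    exact isSymm_transpose_mul_mul hW _
  let R : (Fin np → ℝ) → Matrix (δ ⊕ κ) δ ℝ := fun p => fromRows (Δ p) K
  have hR : Continuous R := by
    refine continuous_matrix fun i j => ?_
    rcases i with i | i
    · exact hΔ.matrix_elem i j
    · exact continuous_const
  -- As `K * L₁₂ = 1`, `L₁₂ * K` projects onto the range of `L₁₂`, which is therefore the kernel of
  -- `C`.
  let C : Matrix δ δ ℝ := 1 - L₁₂ * K
  obtain ⟨M, -, hM⟩ := exists_pos_forall_posDef_add_smul hℙ
    (A := fun p => (R p)ᵀ * N * R p) (B := fun _ => Cᵀ * C)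
    ((hR.matrix_transpose.matrix_mul continuous_const).matrix_mul hR) continuous_const
    (fun p _ => isHermitian_iff_isSymm.2 (isSymm_transpose_mul_mul hNs _))
    (fun p _ => by simpa using posSemidef_conjTranspose_mul_self C) (fun p hp q hq hC => by
      rw [← mulVec_mulVec, dotProduct_mulVec, vecMul_transpose, dotProduct_self_eq_zero] at hC
      have hq1 : L₁₂ *ᵥ (K *ᵥ q) = q := by
        simpa [C, sub_mulVec, sub_eq_zero, eq_comm] using hC
      have hv : K *ᵥ q ≠ 0 := fun h0 => hq (by rw [← hq1, h0, mulVec_zero])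
      have := (h p hp).dotProduct_mulVec_pos hv
      -- For `q = L₁₂ v` with `v = K q`, the pulled-back form at `q` is the closed-loop form at `v`.
      have hRq : fromCols L₂₁ L₂₂ *ᵥ (R p *ᵥ q) = (L₂₁ * Δ p * L₁₂ + L₂₂) *ᵥ (K *ᵥ q) := by
        simp only [R, mulVec_mulVec, fromCols_mul_fromRows]
        simp only [← mulVec_mulVec, add_mulVec, hq1]
      rw [star_trivial, dotProduct_congruence_mulVec] at this
      have h2 : (R p)ᵀ * N * R p
          = (fromCols L₂₁ L₂₂ * R p)ᵀ * W * (fromCols L₂₁ L₂₂ * R p) := by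
        simp only [hN, Matrix.transpose_mul, Matrix.mul_assoc]
      rw [h2, dotProduct_congruence_mulVec, ← mulVec_mulVec, hRq]
      exact this)
  obtain ⟨η, hη, hpos⟩ := exists_pos_forall_posDef_sub_smul hℙ
    (B := fun p => (R p)ᵀ * R p)
    (((hR.matrix_transpose.matrix_mul continuous_const).matrix_mul hR).add continuous_const)
    (hR.matrix_transpose.matrix_mul hR) hM
    (fun p _ => by simpa using (posSemidef_conjTranspose_mul_self (R p)).isHermitian)
  -- These blocks are chosen to act well on both factors. On the outer factor `Φ` below, `Ψ` is a
  -- left inverse and `Γ` vanishes, so the LMI collapses to `-η • 1 ≺ 0`. On `[I; Δ(p)]` they give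
  -- `R p` and `C`, so the multiplier condition is `hpos`.
  let Ψ : Matrix (δ ⊕ κ) (δ ⊕ δ) ℝ := fromBlocks 0 1 K 0
  let Γ : Matrix δ (δ ⊕ δ) ℝ := fromCols C 0
  have hNη : (N - η • (1 : Matrix (δ ⊕ κ) (δ ⊕ κ) ℝ)).IsSymm :=
    hNs.sub (isSymm_one.smul η)
  refine ⟨Ψᵀ * (N - η • (1 : Matrix (δ ⊕ κ) (δ ⊕ κ) ℝ)) * Ψ + M • (Γᵀ * Γ), (isSymm_transpose_mul_mul hNη Ψ).add
    (IsSymm.smul (by simp [IsSymm, Matrix.transpose_mul]) M), ?_, fun p hp => ?_⟩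
  · let Φ : Matrix (δ ⊕ δ) (δ ⊕ κ) ℝ := fromBlocks 0 L₁₂ 1 0
    have hO : outerL 0 L₁₂ L₂₁ L₂₂ =
        fromRows Φ (fromCols L₂₁ L₂₂) := by
      rw [outerL, fromRows_fromCols_eq_fromBlocks]
    have hΨ : Ψ * Φ = 1 := by
      simp [Ψ, Φ, fromBlocks_multiply, hK, fromBlocks_one]
    have hΓ : Γ * Φ = 0 := by
      simp [Γ, Φ, fromCols_mul_fromBlocks, C, Matrix.sub_mul, Matrix.mul_assoc, hK]
    have e : Φᵀ * (Ψᵀ * (N - η • (1 : Matrix (δ ⊕ κ) (δ ⊕ κ) ℝ)) * Ψ + M • (Γᵀ * Γ)) *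
        Φ = (Ψ * Φ)ᵀ * (N - η • (1 : Matrix (δ ⊕ κ) (δ ⊕ κ) ℝ)) *
          (Ψ * Φ) +
          M • ((Γ * Φ)ᵀ * (Γ * Φ)) := by
      simp only [Matrix.transpose_mul, Matrix.mul_add, Matrix.add_mul, Matrix.mul_smul,
        Matrix.smul_mul, Matrix.mul_assoc]
    rw [hO, fromRows_congruence, e, hΨ, hΓ, Matrix.mul_neg, Matrix.neg_mul, ← hN]
    simpa using (PosDef.one (n := δ ⊕ κ) (R := ℝ)).smul hη
  · have hΨ : Ψ * graphMat (Δ p) = R p := by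
      simp [Ψ, graphMat, R, fromBlocks_mul_fromRows]
    have hΓ : Γ * graphMat (Δ p) = C := by
      simp [Γ, graphMat, fromCols_mul_fromRows]
    have e : (graphMat (Δ p))ᵀ * (Ψᵀ * (N - η • (1 : Matrix (δ ⊕ κ) (δ ⊕ κ) ℝ)) * Ψ + M • (Γᵀ * Γ)) * graphMat (Δ p) =
        (Ψ * graphMat (Δ p))ᵀ * N * (Ψ * graphMat (Δ p)) +
          M • ((Γ * graphMat (Δ p))ᵀ * (Γ * graphMat (Δ p))) -
          η • ((Ψ * graphMat (Δ p))ᵀ * (Ψ * graphMat (Δ p))) := by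
      simp only [Matrix.transpose_mul, Matrix.mul_add, Matrix.add_mul, Matrix.mul_sub,
        Matrix.sub_mul, Matrix.mul_smul, Matrix.smul_mul, Matrix.mul_assoc, Matrix.one_mul]
      abel
    rw [e, hΨ, hΓ]
    exact (hpos p hp).posSemidef

/-- Without uncertainty channels the closed loop is `L₂₂` alone, and any one point of `ℙ` supplies
the strict inequality. This serves `np = 0`, where `L₁₂` has no rows and need not have a left
inverse. -/
lemma multiplierLMI_zero_of_isEmpty [IsEmpty δ] (hne : ℙ.Nonempty)
    (h : ∀ p ∈ ℙ, ((L₂₁ * Δ p * L₁₂ + L₂₂)ᵀ * W * (L₂₁ * Δ p * L₁₂ + L₂₂)).PosDef) :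
    MultiplierLMI ℙ Δ W 0 L₁₂ L₂₁ L₂₂ 0 := by
  obtain ⟨p, hp⟩ := hne
  refine ⟨?_, fun p _ => by simpa using PosSemidef.zero⟩
  have hp := h p hp
  rw [Matrix.mul_assoc L₂₁, Subsingleton.elim (Δ p * L₁₂) 0, Matrix.mul_zero, zero_add] at hp
  have h1 := hp.submatrix (e := (Equiv.emptySum δ κ)) (Equiv.injective _)
  convert h1 using 1
  rw [outerL, fromRows_congruence]
  ext i j
  rcases i with i | i
  · exact isEmptyElim i
  rcases j with j | j
  · exact isEmptyElim j
  simp [Matrix.mul_apply]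

end SProcedure

/-! ### Specialisation to the synthesis inequalities. -/

section Synthesis

variable {nx nu np T : ℕ}

lemma posDef_fromBlocks_zero_iff {m n : Type*} [Fintype m] [Fintype n] {A : Matrix m m ℝ}
    {B : Matrix n n ℝ} : (fromBlocks A 0 0 B).PosDef ↔ A.PosDef ∧ B.PosDef := by
  refine ⟨fun h => ⟨h.submatrix (e := Sum.inl) Sum.inl_injective,
    h.submatrix (e := Sum.inr) Sum.inr_injective⟩, fun ⟨hA, hB⟩ => .of_dotProduct_mulVec_pos
      (hA.isHermitian.fromBlocks (by simp) hB.isHermitian) fun x hx => ?_⟩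
  obtain ⟨a, b, rfl⟩ : ∃ a b, x = Sum.elim a b := ⟨_, _, (Sum.elim_comp_inl_inr x).symm⟩
  have key : star (Sum.elim a b) ⬝ᵥ (fromBlocks A 0 0 B *ᵥ Sum.elim a b) =
      star a ⬝ᵥ (A *ᵥ a) + star b ⬝ᵥ (B *ᵥ b) := by
    simp [fromBlocks_mulVec, sumElim_dotProduct_sumElim]
  rw [key]
  by_cases ha : a = 0
  · have hb : b ≠ 0 := by
      rintro rfl
      exact hx (by simp [ha])
    exact add_pos_of_nonneg_of_pos (hA.posSemidef.dotProduct_mulVec_nonneg a)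
      (hB.dotProduct_mulVec_pos hb)
  · exact add_pos_of_pos_of_nonneg (hA.dotProduct_mulVec_pos ha)
      (hB.posSemidef.dotProduct_mulVec_nonneg b)

lemma diagonal_kronecker_mul_kronVec (n : ℕ) (p : Fin np → ℝ) :
    diagonal p ⊗ₖ (1 : Matrix (Fin n) (Fin n) ℝ) *
      kronVec (fun _ : Fin np => 1) (1 : Matrix (Fin n) (Fin n) ℝ) = kronVec p 1 := by
  ext ⟨i, a⟩ j
  simp [Matrix.mul_apply, kronVec, Fintype.sum_prod_type, diagonal_apply, one_apply, mul_ite]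

lemma blkdiag4_mul {l₁ l₂ l₃ l₄ m₁ m₂ m₃ m₄ n₁ n₂ n₃ n₄ : Type*} [Fintype m₁] [Fintype m₂]
    [Fintype m₃] [Fintype m₄] (A : Matrix l₁ m₁ ℝ) (B : Matrix l₂ m₂ ℝ) (C : Matrix l₃ m₃ ℝ)
    (D : Matrix l₄ m₄ ℝ) (A' : Matrix m₁ n₁ ℝ) (B' : Matrix m₂ n₂ ℝ) (C' : Matrix m₃ n₃ ℝ)
    (D' : Matrix m₄ n₄ ℝ) :
    blkdiag4 A B C D * blkdiag4 A' B' C' D' = blkdiag4 (A * A') (B * B') (C * C') (D * D') := by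
  simp [blkdiag4, fromBlocks_multiply]

lemma fromRows_zero_one_mul_add (n : ℕ) (p : Fin np → ℝ) :
    (fromRows 0 1 : Matrix (Fin n ⊕ Fin np × Fin n) (Fin np × Fin n) ℝ) *
        kronVec p (1 : Matrix (Fin n) (Fin n) ℝ) + fromRows (1 : Matrix (Fin n) (Fin n) ℝ) 0 = lift₁ n p := by
  rw [fromRows_mul, lift₁]
  ext (i | i) j <;> simp

lemma L21_mul_Delta_mul_L12_add_L22 (p : Fin np → ℝ) :
    L21 nx np T * Delta nx T p * L12 nx np T + L22 nx np T =
      blkdiag4 (lift₁ nx p) (lift₁ nx p) (lift₁ T p) (lift₁ nx p) := by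
  rw [Matrix.mul_assoc, L21, Delta, L12, L22, blkdiag4_mul, blkdiag4_mul]
  simp only [diagonal_kronecker_mul_kronVec, ← fromRows_zero_one_mul_add]
  simp [blkdiag4, fromBlocks_add]

/-- The zero padding meets only the `p ⊗ I` part of the lift; the identity part returns `M`. -/
lemma transpose_lift₁_mul_pad_mul {n : ℕ} (M : Matrix (Fin n) (Fin n) ℝ) (p : Fin np → ℝ) :
    (lift₁ n p)ᵀ * pad np M * lift₁ n p = M := by
  rw [lift₁, pad, fromRows_congruence]
  simp

/-- Moves `Z₊` out through the lift, so that `𝒵₊ F_Q` collapses to `Z₊ F(p)`. -/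
lemma transpose_lift₁_mul_calZplus (D : Experiment nx nu np T) (p : Fin np → ℝ) :
    (lift₁ nx p)ᵀ * calZplus D = D.Zplus * (lift₁ T p)ᵀ := by
  rw [lift₁, lift₁, calZplus, transpose_fromRows, transpose_fromRows, fromCols_mul_fromBlocks,
    mul_fromCols]
  congr 1
  · simp
  · ext a ⟨i, t⟩
    simp [Matrix.mul_apply, kronVec, Fintype.sum_prod_type, one_apply, ite_mul, mul_ite, mul_comm]

lemma congruence_Wmat (D : Experiment nx nu np T) (α : ℝ) (P : Matrix (Fin nx) (Fin nx) ℝ)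
    (FQ : Matrix (Fin T ⊕ Fin np × Fin T) (Fin nx ⊕ Fin np × Fin nx) ℝ) (p : Fin np → ℝ) :
    (blkdiag4 (lift₁ nx p) (lift₁ nx p) (lift₁ T p) (lift₁ nx p))ᵀ * Wmat D α P FQ *
        blkdiag4 (lift₁ nx p) (lift₁ nx p) (lift₁ T p) (lift₁ nx p) =
      fromBlocks
        (fromBlocks (P - α • (D.Zplus * D.Zplusᵀ)) (D.Zplus * Fof FQ p)
          (D.Zplus * Fof FQ p)ᵀ P) 0 0
        (fromBlocks 1 (Fof FQ p) (Fof FQ p)ᵀ P) := by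
  have h1 : (lift₁ nx p)ᵀ * (calZplus D * FQ) * lift₁ nx p = D.Zplus * Fof FQ p := by
    rw [← Matrix.mul_assoc, transpose_lift₁_mul_calZplus, Fof]
    simp only [Matrix.mul_assoc]
  have h2 : (lift₁ nx p)ᵀ * (calZplus D * FQ)ᵀ * lift₁ nx p = (D.Zplus * Fof FQ p)ᵀ := by
    rw [← h1]
    simp [Matrix.transpose_mul, Matrix.mul_assoc]
  have h3 : (lift₁ nx p)ᵀ * FQᵀ * lift₁ T p = (Fof FQ p)ᵀ := by
    simp [Fof, Matrix.transpose_mul, Matrix.mul_assoc]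
  simp only [blkdiag4, Wmat, fromBlocks_transpose, fromBlocks_multiply, transpose_zero,
    Matrix.zero_mul, Matrix.mul_zero, add_zero, zero_add, transpose_lift₁_mul_pad_mul, h1, h2, h3]
  rw [Fof]

lemma synthesisIneq_iff_posDef {D : Experiment nx nu np T} {α : ℝ}
    {P : Matrix (Fin nx) (Fin nx) ℝ}
    {FQ : Matrix (Fin T ⊕ Fin np × Fin T) (Fin nx ⊕ Fin np × Fin nx) ℝ} {p : Fin np → ℝ} :
    SynthesisIneq D α P FQ p ↔
      ((L21 nx np T * Delta nx T p * L12 nx np T + L22 nx np T)ᵀ * Wmat D α P FQ *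
        (L21 nx np T * Delta nx T p * L12 nx np T + L22 nx np T)).PosDef := by
  rw [L21_mul_Delta_mul_L12_add_L22, congruence_Wmat, posDef_fromBlocks_zero_iff, SynthesisIneq]

lemma isSymm_Wmat (D : Experiment nx nu np T) (α : ℝ) {P : Matrix (Fin nx) (Fin nx) ℝ}
    (hP : P.IsSymm) (FQ : Matrix (Fin T ⊕ Fin np × Fin T) (Fin nx ⊕ Fin np × Fin nx) ℝ) :
    (Wmat D α P FQ).IsSymm := by
  have hpad {n : ℕ} {M : Matrix (Fin n) (Fin n) ℝ} (hM : M.IsSymm) : (pad np M).IsSymm :=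
    hM.fromBlocks (by simp) isSymm_zero
  have hZ : (P - α • (D.Zplus * D.Zplusᵀ)).IsSymm :=
    hP.sub (IsSymm.smul (by simp [IsSymm, Matrix.transpose_mul]) α)
  exact ((hpad hZ).fromBlocks rfl (hpad hP)).fromBlocks (by simp)
    ((hpad isSymm_one).fromBlocks rfl (hpad hP))

lemma continuous_Delta : Continuous (Delta (np := np) nx T) := by
  have h (n : ℕ) : Continuous fun p : Fin np → ℝ =>
      diagonal p ⊗ₖ (1 : Matrix (Fin n) (Fin n) ℝ) :=
    continuous_matrix fun i j => by
      exact ((continuous_id.matrix_diagonal).matrix_elem _ _).mul continuous_const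
  exact (((h nx).matrix_fromBlocks continuous_const continuous_const (h nx)).matrix_fromBlocks
    continuous_const continuous_const
    ((h T).matrix_fromBlocks continuous_const continuous_const (h nx)))

lemma exists_leftInverse_L12 (i₀ : Fin np) :
    ∃ K : Matrix (LIdx nx T) (DeltaIdx nx np T) ℝ, K * L12 nx np T = 1 := by
  -- Selects the `i₀`-th copy of `I` in `1 ⊗ I`, which requires at least one scheduling coordinate.
  let k (n : ℕ) : Matrix (Fin n) (Fin np × Fin n) ℝ := (kronVec (Pi.single i₀ 1) 1)ᵀ
  have hk (n : ℕ) : k n * kronVec (fun _ : Fin np => 1) (1 : Matrix (Fin n) (Fin n) ℝ) = 1 := by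
    ext a b
    simp [k, Matrix.mul_apply, kronVec, Fintype.sum_prod_type, one_apply, Pi.single_apply,
      eq_comm]
  refine ⟨blkdiag4 (k nx) (k nx) (k T) (k nx), ?_⟩
  rw [L12, blkdiag4_mul, hk, hk, blkdiag4, fromBlocks_one, fromBlocks_one, fromBlocks_one]

theorem forall_synthesisIneq_iff_exists_noisyLMI {ℙ : Set (Fin np → ℝ)} (hne : ℙ.Nonempty)
    (hℙ : IsCompact ℙ) (D : Experiment nx nu np T) (α : ℝ) {P : Matrix (Fin nx) (Fin nx) ℝ}
    (hP : P.IsSymm) (FQ : Matrix (Fin T ⊕ Fin np × Fin T) (Fin nx ⊕ Fin np × Fin nx) ℝ) :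
    (∀ p ∈ ℙ, SynthesisIneq D α P FQ p) ↔
      ∃ Ξ : Matrix (DeltaIdx nx np T ⊕ DeltaIdx nx np T) (DeltaIdx nx np T ⊕ DeltaIdx nx np T) ℝ,
        Ξ.IsSymm ∧ NoisyLMI D ℙ α P FQ Ξ := by
  simp only [synthesisIneq_iff_posDef, NoisyLMI]
  refine ⟨fun h => ?_, fun ⟨Ξ, _, hΞ⟩ p hp => MultiplierLMI.posDef hΞ hp⟩
  cases np with
  | zero => exact ⟨0, isSymm_zero, multiplierLMI_zero_of_isEmpty hne h⟩
  | succ m =>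
    obtain ⟨K, hK⟩ := exists_leftInverse_L12 (nx := nx) (T := T) (0 : Fin (m + 1))
    exact exists_multiplierLMI_of_leftInverse hℙ continuous_Delta (isSymm_Wmat D α hP FQ) hK h

lemma SynthesisIneq.posDef {D : Experiment nx nu np T} {α : ℝ} {P : Matrix (Fin nx) (Fin nx) ℝ}
    {FQ : Matrix (Fin T ⊕ Fin np × Fin T) (Fin nx ⊕ Fin np × Fin nx) ℝ} {p : Fin np → ℝ}
    (h : SynthesisIneq D α P FQ p) : P.PosDef :=
  h.2.submatrix (e := Sum.inr) Sum.inr_injective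

end Synthesis

end LPV

theorem proposition1 {nx nu np T : ℕ}
    (ℙ : Set (Fin np → ℝ)) (hne : ℙ.Nonempty) (hcompact : IsCompact ℙ) (hconvex : Convex ℝ ℙ)
    (S : LPV.System nx nu np) (D : LPV.Experiment nx nu np T) (hD : D.IsTrajectoryOf S ℙ)
    (hPE : D.PersistentlyExciting)
    (ε : ℝ) (hε : 0 < ε) (hnoise : D.NoiseBound S ε) :
    -- pointwise in the decision variables
    (∀ (α : ℝ) (P : Matrix (Fin nx) (Fin nx) ℝ)
        (FQ : Matrix (Fin T ⊕ Fin np × Fin T) (Fin nx ⊕ Fin np × Fin nx) ℝ)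
        (calF : Matrix (Fin T) (Fin nx ⊕ (Fin np × Fin nx) ⊕ (Fin np × Fin np × Fin nx)) ℝ)
        (Y₀ : Matrix (Fin nu) (Fin nx) ℝ) (Ybar : Matrix (Fin nu) (Fin np × Fin nx) ℝ),
        0 < α → P.IsSymm → LPV.SameF ℙ calF FQ →
        ((LPV.Coupling D P Y₀ Ybar calF ∧ ∀ p ∈ ℙ, LPV.SynthesisIneq D α P FQ p) ↔
          (P.PosDef ∧ LPV.Coupling D P Y₀ Ybar calF ∧
            ∃ Ξ : Matrix (LPV.DeltaIdx nx np T ⊕ LPV.DeltaIdx nx np T)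
                (LPV.DeltaIdx nx np T ⊕ LPV.DeltaIdx nx np T) ℝ,
              Ξ.IsSymm ∧ LPV.NoisyLMI D ℙ α P FQ Ξ))) ∧
    -- equivalence of the two feasibility problems
    ((∃ (α : ℝ) (P : Matrix (Fin nx) (Fin nx) ℝ)
        (FQ : Matrix (Fin T ⊕ Fin np × Fin T) (Fin nx ⊕ Fin np × Fin nx) ℝ)
        (calF : Matrix (Fin T) (Fin nx ⊕ (Fin np × Fin nx) ⊕ (Fin np × Fin np × Fin nx)) ℝ)
        (Y₀ : Matrix (Fin nu) (Fin nx) ℝ) (Ybar : Matrix (Fin nu) (Fin np × Fin nx) ℝ),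
        0 < α ∧ P.IsSymm ∧ LPV.SameF ℙ calF FQ ∧ LPV.Coupling D P Y₀ Ybar calF ∧
          ∀ p ∈ ℙ, LPV.SynthesisIneq D α P FQ p) ↔
      ∃ (α : ℝ) (P : Matrix (Fin nx) (Fin nx) ℝ)
        (FQ : Matrix (Fin T ⊕ Fin np × Fin T) (Fin nx ⊕ Fin np × Fin nx) ℝ)
        (calF : Matrix (Fin T) (Fin nx ⊕ (Fin np × Fin nx) ⊕ (Fin np × Fin np × Fin nx)) ℝ)
        (Y₀ : Matrix (Fin nu) (Fin nx) ℝ) (Ybar : Matrix (Fin nu) (Fin np × Fin nx) ℝ)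
        (Ξ : Matrix (LPV.DeltaIdx nx np T ⊕ LPV.DeltaIdx nx np T)
          (LPV.DeltaIdx nx np T ⊕ LPV.DeltaIdx nx np T) ℝ),
        0 < α ∧ P.PosDef ∧ LPV.SameF ℙ calF FQ ∧ LPV.Coupling D P Y₀ Ybar calF ∧
          Ξ.IsSymm ∧ LPV.NoisyLMI D ℙ α P FQ Ξ) := by
  have key (α : ℝ) (P : Matrix (Fin nx) (Fin nx) ℝ)
      (FQ : Matrix (Fin T ⊕ Fin np × Fin T) (Fin nx ⊕ Fin np × Fin nx) ℝ) (hP : P.IsSymm) :=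
    LPV.forall_synthesisIneq_iff_exists_noisyLMI hne hcompact D α hP FQ
  obtain ⟨p₀, hp₀⟩ := hne
  -- `P ≻ 0` is read off as a diagonal block of the second inequality at the single point `p₀`.
  refine ⟨fun α P FQ calF Y₀ Ybar _ hP _ => ⟨fun ⟨hc, h⟩ => ⟨(h p₀ hp₀).posDef, hc,
    (key α P FQ hP).1 h⟩, fun ⟨_, hc, h⟩ => ⟨hc, (key α P FQ hP).2 h⟩⟩, ?_, ?_⟩
  · rintro ⟨α, P, FQ, calF, Y₀, Ybar, hα, hP, hF, hc, h⟩
    obtain ⟨Ξ, hΞ, hL⟩ := (key α P FQ hP).1 h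
    exact ⟨α, P, FQ, calF, Y₀, Ybar, Ξ, hα, (h p₀ hp₀).posDef, hF, hc, hΞ, hL⟩
  · rintro ⟨α, P, FQ, calF, Y₀, Ybar, Ξ, hα, hPD, hF, hc, hΞ, hL⟩
    have hP : P.IsSymm := isHermitian_iff_isSymm.1 hPD.isHermitian
    exact ⟨α, P, FQ, calF, Y₀, Ybar, hα, hP, hF, hc, (key α P FQ hP).2 ⟨Ξ, hΞ, hL⟩⟩
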